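/- Let $\mathcal X,\mathcal A,\mathcal Z$ be measurable spaces (features, sensitive attribute, representations) and let $\mathcal Y$ be a finite set of labels with all subsets measurable; let $\mathcal Y^{\Delta}$ be the simplex of probability vectors indexed by $\mathcal Y$. A domain $D$ is a probability distribution of $(X,A,Y)$ on $\mathcal X\times\mathcal A\times\mathcal Y$, and $P_D^{X,Y}$ is the induced joint law of $(X,Y)$. A representation map $g:\mathcal X\to\mathcal Z$ may be stochastic, i.e. it is a Markov kernel from $\mathcal X$ to $\mathcal Z$ (a deterministic measurable map is a special case); $Z$ is drawn from $g(X)$, conditionally independently of $Y$ given $X$, and $P_D^{Z,Y}$ is the resulting joint law of $(Z,Y)$. For a measurable $\widehat h:\mathcal Z\to\mathcal Y^{\Delta}$ put $\widehat f=\widehat h\circ g$, i.e. $\widehat f(X)=\widehat h(Z)$, and for a loss $\mathcal L:\mathcal Y^{\Delta}\times\mathcal Y\to[0,\infty)$ put $\epsilon_D(\widehat f)=\mathbb E_D[\mathcal L(\widehat f(X),Y)]$. For probability measures $P,P'$ let $d_{JS}(P,P')=\sqrt{\tfrac12 D_{KL}(P\,\|\,\tfrac{P+P'}2)+\tfrac12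 D_{KL}(P'\,\|\,\tfrac{P+P'}2)}$, where $D_{KL}$ is the Kullback–Leibler divergence with natural logarithm. Let $N\ge 1$, let $D^S_1,\dots,D^S_N$ be source domains and $D^T$ any target domain. For every $\widehat h$ and $g$ as above and every measurable loss $\mathcal L:\mathcal Y^{\Delta}\times\mathcal Y\to[0,\infty)$ that is bounded above by $C$, $$\epsilon_{D^T}(\widehat f)\;\le\;\frac1N\sum_{i=1}^N\epsilon_{D^S_i}(\widehat f)\;+\;\sqrt2\,C\min_{1\le i\le N}d_{JS}\big(P_{D^T}^{X,Y},P_{D^S_i}^{X,Y}\big)\;+\;\sqrt2\,C\max_{1\le i,j\le N}d_{JS}\big(P_{D^S_i}^{Z,Y},P_{D^S_j}^{Z,Y}\big).$$ -/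

import Mathlib

open MeasureTheory ProbabilityTheory InformationTheory
open scoped ENNReal

namespace DomainGeneralization

noncomputable section

/-- Jensen–Shannon divergence
`D_JS(P‖Q) = ½ KL(P ‖ (P+Q)/2) + ½ KL(Q ‖ (P+Q)/2)` (natural logarithm). -/
def jsDiv {Ω : Type*} [MeasurableSpace Ω] (P Q : Measure Ω) : ℝ≥0∞ :=
  2⁻¹ * klDiv P ((2⁻¹ : ℝ≥0∞) • (P + Q)) + 2⁻¹ * klDiv Q ((2⁻¹ : ℝ≥0∞) • (P + Q))

/-- Jensen–Shannon distance: the square root of the Jensen–Shannon divergence.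
The divergence of two probability measures is finite, so `toReal` loses nothing. -/
def jsDist {Ω : Type*} [MeasurableSpace Ω] (P Q : Measure Ω) : ℝ :=
  Real.sqrt (jsDiv P Q).toReal

/-- A domain: a probability distribution of (features, sensitive attribute, label).
The labeling function of the domain is the conditional distribution of the label given the
features; it is determined by the joint distribution. -/
abbrev Domain (X A Y : Type*) [MeasurableSpace X] [MeasurableSpace A] [MeasurableSpace Y] :=
  ProbabilityMeasure (X × A × Y)

variable {X A Z Y : Type*} [MeasurableSpace X] [MeasurableSpace A] [MeasurableSpace Z]
  [MeasurableSpace Y]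

/-- The joint law `P_D^{X,Y}` of features and label in the domain `D`. -/
def lawXY (D : Domain X A Y) : Measure (X × Y) :=
  (D : Measure (X × A × Y)).map (fun ω => (ω.1, ω.2.2))

/-- The joint law `P_D^{Z,Y}` of representation and label in the domain `D`, where the
representation `Z` is drawn from `g X`, conditionally independently of `Y` given `X`. For a
deterministic representation map this is the law of `(g X, Y)`. -/
def lawZY (g : Kernel X Z) (D : Domain X A Y) : Measure (Z × Y) :=
  (g ∥ₖ Kernel.id) ∘ₘ lawXY D

/-- The (stochastic) model `f̂ = ĥ ∘ g`: on input `x` it draws `z` from `g x` and predicts the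
probability vector `ĥ z`. -/
def model [Fintype Y] (h : Z → stdSimplex ℝ Y) (g : Kernel X Z) : Kernel X (stdSimplex ℝ Y) :=
  g.map h

/-- The expected error `E_D[L(f̂(X), Y)]`, where `f̂(X)` is drawn, given `(X, Y)`, from the
kernel `f` at `X`. -/
def expectedError [Fintype Y] (L : stdSimplex ℝ Y → Y → ℝ) (f : Kernel X (stdSimplex ℝ Y))
    (D : Domain X A Y) : ℝ :=
  ∫ xy, ∫ p, L p xy.2 ∂(f xy.1) ∂(lawXY D)

end

end DomainGeneralization

open MeasureTheory ProbabilityTheory InformationTheory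
open scoped ENNReal

namespace DomainGeneralization

/-! Everything reduces to one estimate, `integral_sub_integral_le_jsDist`: changing the law of an
observable with values in `[0, C]` moves its mean by at most `√2 C` times the Jensen–Shannon
distance. With respect to the midpoint the two densities are `1 + t` and `1 - t` with `|t| ≤ 1`; the
means differ by at most `C ∫ |t|`, and `(∫ |t|)² ≤ ∫ t² ≤ 2 * JS` by Cauchy–Schwarz and
`sq_le_klFun_add_klFun`. The error is the mean of a bounded observable of `(X, Y)` and also of `(Z,
Y)`. The first view compares the target with its nearest source, the second compares that source
with every source; averaging the latter gives the bound. -/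

lemma sq_le_klFun_add_klFun_of_nonneg {t : ℝ} (h0 : 0 ≤ t) (h1 : t ≤ 1) :
    t ^ 2 ≤ klFun (1 + t) + klFun (1 - t) := by
  have hmono : MonotoneOn (fun s : ℝ => klFun (1 + s) + klFun (1 - s) - s ^ 2)
      (Set.Icc 0 1) := by
    have hderiv : ∀ s ∈ Set.Ioo (0 : ℝ) 1,
        HasDerivAt (fun s : ℝ => klFun (1 + s) + klFun (1 - s) - s ^ 2)
          (Real.log (1 + s) + -Real.log (1 - s) - 2 * s) s := by
      intro s hs
      have e1 : HasDerivAt (fun s : ℝ => klFun (1 + s)) (Real.log (1 + s)) s := by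
        simpa using (hasDerivAt_klFun (x := 1 + s) (by linarith [hs.1])).comp_const_add 1 s
      have e2 : HasDerivAt (fun s : ℝ => klFun (1 - s)) (-Real.log (1 - s)) s := by
        simpa using (hasDerivAt_klFun (x := 1 - s) (by linarith [hs.2])).comp_const_sub 1 s
      have e3 : HasDerivAt (fun s : ℝ => s ^ 2) (2 * s) s := by
        simpa using hasDerivAt_pow 2 s
      exact (e1.add e2).sub e3
    have hcont := continuous_klFun
    refine monotoneOn_of_deriv_nonneg (convex_Icc 0 1) (by fun_prop) ?_ ?_
    · rw [interior_Icc]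
      exact fun s hs => (hderiv s hs).differentiableAt.differentiableWithinAt
    · rw [interior_Icc]
      intro s hs
      rw [(hderiv s hs).deriv]
      -- `2 * s` is the leading term of the series of `log (1 + s) - log (1 - s)`, whose terms are
      -- all nonnegative.
      have hsum := Real.hasSum_log_sub_log_of_abs_lt_one
        (x := s) (by rw [abs_of_pos hs.1]; exact hs.2)
      have := le_hasSum hsum 0 (fun k _ => by have := hs.1.le; positivity)
      norm_num at this
      linarith
  have := hmono (Set.left_mem_Icc.2 zero_le_one) (Set.mem_Icc.2 ⟨h0, h1⟩) h0
  simp [klFun_one] at this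
  linarith

lemma sq_le_klFun_add_klFun {t : ℝ} (ht : |t| ≤ 1) :
    t ^ 2 ≤ klFun (1 + t) + klFun (1 - t) := by
  rcases le_total 0 t with h | h
  · exact sq_le_klFun_add_klFun_of_nonneg h (by rwa [abs_of_nonneg h] at ht)
  · have := sq_le_klFun_add_klFun_of_nonneg (t := -t) (by linarith)
      (by rwa [abs_of_nonpos h] at ht)
    rw [neg_sq, sub_neg_eq_add, ← sub_eq_add_neg] at this
    linarith

section Measures

variable {Ω : Type*} [MeasurableSpace Ω]

lemma integrable_of_measurable_of_le (μ : Measure Ω) [IsFiniteMeasure μ] {f : Ω → ℝ}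
    (hf : Measurable f) {a b : ℝ} (ha : ∀ ω, a ≤ f ω) (hb : ∀ ω, f ω ≤ b) : Integrable f μ :=
  Integrable.of_bound hf.aestronglyMeasurable (max |a| |b|)
    (ae_of_all _ fun ω => abs_le_max_abs_abs (ha ω) (hb ω))

/-- The densities of two probability measures with respect to their midpoint sum to `2`. -/
lemma rnDeriv_midpoint_add (P Q : Measure Ω) [IsProbabilityMeasure P] [IsProbabilityMeasure Q] :
    ∀ᵐ ω ∂((2⁻¹ : ℝ≥0∞) • (P + Q)), P.rnDeriv ((2⁻¹ : ℝ≥0∞) • (P + Q)) ω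
      + Q.rnDeriv ((2⁻¹ : ℝ≥0∞) • (P + Q)) ω = 2 := by
  set M : Measure Ω := (2⁻¹ : ℝ≥0∞) • (P + Q) with hM
  have : IsFiniteMeasure M := ⟨by simp [hM]⟩
  have hPQ : P + Q = (2 : ℝ≥0∞) • M := by
    rw [hM, smul_smul, ENNReal.mul_inv_cancel (by simp) (by simp), one_smul]
  have e1 := Measure.rnDeriv_add P Q M
  rw [hPQ] at e1
  have e2 := Measure.rnDeriv_smul_left_of_ne_top M M (r := 2) (by simp)
  filter_upwards [e1, e2, M.rnDeriv_self] with ω h1 h2 h3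
  rw [Pi.add_apply] at h1
  rw [← h1, h2, Pi.smul_apply, h3]
  simp

instance isProbabilityMeasure_midpoint (P Q : Measure Ω) [IsProbabilityMeasure P]
    [IsProbabilityMeasure Q] : IsProbabilityMeasure ((2⁻¹ : ℝ≥0∞) • (P + Q)) :=
  ⟨by simp [ENNReal.inv_two_add_inv_two]⟩

/-- A bounded observable separates two probability measures by at most a multiple of their
Jensen–Shannon distance. -/
lemma integral_sub_integral_le_jsDist (P Q : Measure Ω) [IsProbabilityMeasure P]
    [IsProbabilityMeasure Q] {φ : Ω → ℝ} (hφ : Measurable φ) {C : ℝ} (h0 : ∀ ω, 0 ≤ φ ω)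
    (hC : ∀ ω, φ ω ≤ C) :
    ∫ ω, φ ω ∂P - ∫ ω, φ ω ∂Q ≤ Real.sqrt 2 * C * jsDist P Q := by
  have hadd := rnDeriv_midpoint_add P Q
  have hdef : jsDist P Q = Real.sqrt (2⁻¹ * klDiv P ((2⁻¹ : ℝ≥0∞) • (P + Q))
    + 2⁻¹ * klDiv Q ((2⁻¹ : ℝ≥0∞) • (P + Q))).toReal := rfl
  have : IsProbabilityMeasure ((2⁻¹ : ℝ≥0∞) • (P + Q)) := inferInstance
  have hPM : P ≪ (2⁻¹ : ℝ≥0∞) • (P + Q) :=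
    (Measure.AbsolutelyContinuous.rfl.add_right Q).trans
      (Measure.absolutelyContinuous_smul (by simp))
  have hQM : Q ≪ (2⁻¹ : ℝ≥0∞) • (P + Q) :=
    (by rw [add_comm]; exact Measure.AbsolutelyContinuous.rfl.add_right P :
      Q ≪ P + Q).trans (Measure.absolutelyContinuous_smul (by simp))
  -- From here on, `M` is any probability measure dominating `P` and `Q` whose densities sum to `2`.
  generalize (2⁻¹ : ℝ≥0∞) • (P + Q) = M at *
  set p : Ω → ℝ := fun ω => (P.rnDeriv M ω).toReal with hp
  set q : Ω → ℝ := fun ω => (Q.rnDeriv M ω).toReal with hq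
  have hpm : Measurable p := (Measure.measurable_rnDeriv P M).ennreal_toReal
  have hqm : Measurable q := (Measure.measurable_rnDeriv Q M).ennreal_toReal
  have hp0 : ∀ ω, 0 ≤ p ω := fun ω => ENNReal.toReal_nonneg
  have hq0 : ∀ ω, 0 ≤ q ω := fun ω => ENNReal.toReal_nonneg
  have hpq : ∀ᵐ ω ∂M, p ω + q ω = 2 := by
    filter_upwards [hadd] with ω h
    have h1 : P.rnDeriv M ω ≠ ∞ := fun e => by simp [e] at h
    have h2 : Q.rnDeriv M ω ≠ ∞ := fun e => by simp [e] at h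
    rw [hp, hq, ← ENNReal.toReal_add h1 h2, h]
    simp
  set t : Ω → ℝ := fun ω => p ω - 1 with ht
  have htm : Measurable t := hpm.sub_const 1
  have ht1 : ∀ᵐ ω ∂M, |t ω| ≤ 1 := by
    filter_upwards [hpq] with ω h
    rw [abs_le, ht]
    constructor <;> linarith [hp0 ω, hq0 ω]
  have hqt : ∀ᵐ ω ∂M, q ω = 1 - t ω := by
    filter_upwards [hpq] with ω h
    simp only [ht]; linarith
  have hpint : Integrable p M := Measure.integrable_toReal_rnDeriv
  have hqint : Integrable q M := Measure.integrable_toReal_rnDeriv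
  have htint : Integrable t M := hpint.sub (integrable_const 1)
  have htabs : Integrable (fun ω => |t ω|) M := htint.abs
  have htsq : Integrable (fun ω => t ω ^ 2) M :=
    Integrable.of_bound (htm.pow_const 2).aestronglyMeasurable 1 (by
      filter_upwards [ht1] with ω h
      rw [Real.norm_eq_abs, abs_pow]
      exact pow_le_one₀ (abs_nonneg _) h)
  -- `klFun` is bounded on `[0, 2]`, so both divergences are finite and `toReal` does not collapse
  -- to `0`.
  have hkl_int : ∀ {f : Ω → ℝ}, Measurable f → (∀ ω, 0 ≤ f ω) → (∀ᵐ ω ∂M, f ω ≤ 2) →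
      Integrable (fun ω => klFun (f ω)) M := by
    intro f hf hf0 hf2
    obtain ⟨B, hB⟩ := (isCompact_Icc (a := (0 : ℝ)) (b := 2)).exists_bound_of_continuousOn
      continuous_klFun.continuousOn
    refine Integrable.of_bound (measurable_klFun.comp hf).aestronglyMeasurable B ?_
    filter_upwards [hf2] with ω h
    exact hB _ ⟨hf0 ω, h⟩
  have hkp : Integrable (fun ω => klFun (p ω)) M := hkl_int hpm hp0 (by
    filter_upwards [hpq] with ω h
    linarith [hq0 ω])
  have hkq : Integrable (fun ω => klFun (q ω)) M := hkl_int hqm hq0 (by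
    filter_upwards [hpq] with ω h
    linarith [hp0 ω])
  have hklP : klDiv P M ≠ ∞ := klDiv_ne_top hPM ((integrable_klFun_rnDeriv_iff hPM).1 hkp)
  have hklQ : klDiv Q M ≠ ∞ := klDiv_ne_top hQM ((integrable_klFun_rnDeriv_iff hQM).1 hkq)
  have hjs : (2⁻¹ * klDiv P M + 2⁻¹ * klDiv Q M).toReal
      = 2⁻¹ * ∫ ω, (klFun (p ω) + klFun (q ω)) ∂M := by
    rw [ENNReal.toReal_add (ENNReal.mul_ne_top (by simp) hklP)
      (ENNReal.mul_ne_top (by simp) hklQ), ENNReal.toReal_mul, ENNReal.toReal_mul,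
      toReal_klDiv_eq_integral_klFun hPM, toReal_klDiv_eq_integral_klFun hQM,
      integral_add hkp hkq]
    simp only [ENNReal.toReal_inv, ENNReal.toReal_ofNat]
    ring
  have hsq : ∫ ω, t ω ^ 2 ∂M ≤ ∫ ω, (klFun (p ω) + klFun (q ω)) ∂M := by
    refine integral_mono_ae htsq (hkp.add hkq) ?_
    filter_upwards [ht1, hqt] with ω h h'
    have := sq_le_klFun_add_klFun h
    rw [h']
    simpa [ht] using this
  -- The variance of `|t|` is nonnegative.
  have hcs : (∫ ω, |t ω| ∂M) ^ 2 ≤ ∫ ω, t ω ^ 2 ∂M := by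
    set a := ∫ ω, |t ω| ∂M with ha
    have h : 0 ≤ ∫ ω, (|t ω| - a) ^ 2 ∂M := integral_nonneg fun ω => sq_nonneg _
    have e : ∫ ω, (|t ω| - a) ^ 2 ∂M = ∫ ω, t ω ^ 2 ∂M - 2 * a * a + a ^ 2 := by
      have : (fun ω => (|t ω| - a) ^ 2) = fun ω => (t ω ^ 2 - 2 * a * |t ω|) + a ^ 2 := by
        funext ω
        rw [← sq_abs (t ω)]
        ring
      have hi : Integrable (fun ω => t ω ^ 2 - 2 * a * |t ω|) M :=
        htsq.sub (htabs.const_mul (2 * a))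
      rw [this, integral_add hi (integrable_const _),
        integral_sub htsq (htabs.const_mul _), integral_const_mul, ← ha]
      simp
    nlinarith
  have hC0 : 0 ≤ C := by
    obtain ⟨ω⟩ := P.nonempty_of_neZero
    exact (h0 ω).trans (hC ω)
  have hφp : Integrable (fun ω => p ω * φ ω) M :=
    hpint.mul_bdd (c := C) hφ.aestronglyMeasurable
      (ae_of_all _ fun ω => by rw [Real.norm_eq_abs, abs_of_nonneg (h0 ω)]; exact hC ω)
  have hφq : Integrable (fun ω => q ω * φ ω) M :=
    hqint.mul_bdd (c := C) hφ.aestronglyMeasurable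
      (ae_of_all _ fun ω => by rw [Real.norm_eq_abs, abs_of_nonneg (h0 ω)]; exact hC ω)
  have hP : ∫ ω, φ ω ∂P = ∫ ω, p ω * φ ω ∂M := by
    rw [← integral_rnDeriv_smul hPM]; rfl
  have hQ : ∫ ω, φ ω ∂Q = ∫ ω, q ω * φ ω ∂M := by
    rw [← integral_rnDeriv_smul hQM]; rfl
  have ht0 : ∫ ω, t ω ∂M = 0 := by
    rw [ht, integral_sub hpint (integrable_const 1), Measure.integral_toReal_rnDeriv hPM]
    simp
  have hle : ∫ ω, φ ω ∂P - ∫ ω, φ ω ∂Q ≤ C * ∫ ω, |t ω| ∂M := by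
    rw [hP, hQ, ← integral_sub hφp hφq]
    -- Pointwise `2 t φ ≤ C (|t| + t)` because `0 ≤ φ ≤ C`. As `t` has mean zero, this saves a
    -- factor `2` over `2 C |t|`.
    have h : ∫ ω, (p ω * φ ω - q ω * φ ω) ∂M ≤ ∫ ω, (C * |t ω| + C * t ω) ∂M := by
      refine integral_mono_ae (hφp.sub hφq) ((htabs.const_mul C).add (htint.const_mul C)) ?_
      filter_upwards [hqt] with ω h
      have h' : p ω = 1 + t ω := by simp [ht]
      simp only [h, h']
      nlinarith [mul_nonneg (h0 ω) (sub_nonneg.2 (neg_le_abs (t ω))),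
        mul_nonneg (h0 ω) (sub_nonneg.2 (le_abs_self (t ω))),
        mul_nonneg (sub_nonneg.2 (hC ω)) (sub_nonneg.2 (neg_le_abs (t ω))),
        mul_nonneg (sub_nonneg.2 (hC ω)) (sub_nonneg.2 (le_abs_self (t ω)))]
    rwa [integral_add (htabs.const_mul C) (htint.const_mul C), integral_const_mul,
      integral_const_mul, ht0, mul_zero, add_zero] at h
  refine hle.trans ?_
  rw [mul_comm (Real.sqrt 2) C, mul_assoc, hdef, hjs, ← Real.sqrt_mul (by norm_num)]
  refine mul_le_mul_of_nonneg_left (Real.le_sqrt_of_sq_le ?_) hC0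
  linarith

end Measures

section Errors

variable {X A Z Y : Type*} [MeasurableSpace X] [MeasurableSpace A] [MeasurableSpace Z]
  [MeasurableSpace Y]

instance isProbabilityMeasure_lawXY (D : Domain X A Y) : IsProbabilityMeasure (lawXY D) :=
  Measure.isProbabilityMeasure_map (by fun_prop)

instance isProbabilityMeasure_lawZY (g : Kernel X Z) [IsMarkovKernel g] (D : Domain X A Y) :
    IsProbabilityMeasure (lawZY g D) := by
  unfold lawZY
  infer_instance

variable [Fintype Y] [MeasurableSingletonClass Y]

lemma measurable_loss {L : stdSimplex ℝ Y → Y → ℝ} (hL : ∀ y, Measurable fun p => L p y) :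
    Measurable fun py : stdSimplex ℝ Y × Y => L py.1 py.2 :=
  measurable_from_prod_countable_left hL

/-- The expected error is the expectation of the loss under the law of representation and label. -/
lemma expectedError_model_eq_integral_lawZY (g : Kernel X Z) [IsMarkovKernel g]
    {h : Z → stdSimplex ℝ Y} (hh : Measurable h)
    {L : stdSimplex ℝ Y → Y → ℝ} (hL : ∀ y, Measurable fun p => L p y)
    {C : ℝ} (h0 : ∀ p y, 0 ≤ L p y) (hC : ∀ p y, L p y ≤ C) (D : Domain X A Y) :
    expectedError L (model h g) D = ∫ zy, L (h zy.1) zy.2 ∂(lawZY g D) := by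
  have hm : Measurable fun zy : Z × Y => L (h zy.1) zy.2 :=
    (measurable_loss hL).comp ((hh.comp measurable_fst).prodMk measurable_snd)
  rw [lawZY, Measure.comp_eq_comp_const_apply, Kernel.integral_comp
    (integrable_of_measurable_of_le _ hm (fun _ => h0 _ _) (fun _ => hC _ _)),
    Kernel.const_apply]
  refine integral_congr_ae (ae_of_all _ fun xy => ?_)
  simp only [model]
  rw [Kernel.map_apply _ hh, integral_map hh.aemeasurable (hL _).aestronglyMeasurable,
    show xy = (xy.1, xy.2) from rfl, Kernel.parallelComp_apply, Kernel.id_apply,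
    integral_prod _ (integrable_of_measurable_of_le _ hm (fun _ => h0 _ _) (fun _ => hC _ _))]
  simp

/-- The observable is the loss averaged over the prediction drawn from `f x`; it stays in `[0, C]`
since `f` is Markov. -/
lemma expectedError_sub_le_jsDist_lawXY (f : Kernel X (stdSimplex ℝ Y)) [IsMarkovKernel f]
    {L : stdSimplex ℝ Y → Y → ℝ} (hL : ∀ y, Measurable fun p => L p y)
    {C : ℝ} (h0 : ∀ p y, 0 ≤ L p y) (hC : ∀ p y, L p y ≤ C) (D D' : Domain X A Y) :
    expectedError L f D - expectedError L f D'
      ≤ Real.sqrt 2 * C * jsDist (lawXY D) (lawXY D') := by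
  refine integral_sub_integral_le_jsDist _ _ ?_ (fun xy => integral_nonneg fun p => h0 _ _)
    (fun xy => ?_)
  · refine measurable_from_prod_countable_left fun y => ?_
    exact (StronglyMeasurable.integral_kernel (κ := f) (hL y).stronglyMeasurable).measurable
  · calc ∫ p, L p xy.2 ∂(f xy.1) ≤ ∫ _, C ∂(f xy.1) :=
          integral_mono (integrable_of_measurable_of_le _ (hL _) (fun _ => h0 _ _) fun _ => hC _ _)
            (integrable_const C) fun p => hC _ _
      _ = C := by simp

lemma expectedError_sub_le_jsDist_lawZY (g : Kernel X Z) [IsMarkovKernel g]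
    {h : Z → stdSimplex ℝ Y} (hh : Measurable h)
    {L : stdSimplex ℝ Y → Y → ℝ} (hL : ∀ y, Measurable fun p => L p y)
    {C : ℝ} (h0 : ∀ p y, 0 ≤ L p y) (hC : ∀ p y, L p y ≤ C) (D D' : Domain X A Y) :
    expectedError L (model h g) D - expectedError L (model h g) D'
      ≤ Real.sqrt 2 * C * jsDist (lawZY g D) (lawZY g D') := by
  rw [expectedError_model_eq_integral_lawZY g hh hL h0 hC,
    expectedError_model_eq_integral_lawZY g hh hL h0 hC]
  exact integral_sub_integral_le_jsDist _ _
    ((measurable_loss hL).comp ((hh.comp measurable_fst).prodMk measurable_snd))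
    (fun _ => h0 _ _) (fun _ => hC _ _)

end Errors

end DomainGeneralization

theorem theorem1
    {X A Z Y : Type*} [MeasurableSpace X] [MeasurableSpace A] [MeasurableSpace Z]
    [Fintype Y] [MeasurableSpace Y] [MeasurableSingletonClass Y]
    (N : ℕ) (hN : 0 < N)
    (DS : Fin N → DomainGeneralization.Domain X A Y)
    (DT : DomainGeneralization.Domain X A Y)
    (g : ProbabilityTheory.Kernel X Z) [ProbabilityTheory.IsMarkovKernel g]
    (h : Z → stdSimplex ℝ Y) (hh : Measurable h)
    (L : stdSimplex ℝ Y → Y → ℝ) (hL : ∀ y, Measurable (fun p => L p y))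
    (hL_nonneg : ∀ p y, 0 ≤ L p y)
    (C : ℝ) (hLC : ∀ p y, L p y ≤ C) :
    DomainGeneralization.expectedError L (DomainGeneralization.model h g) DT ≤
      (1 / (N : ℝ)) * ∑ i : Fin N,
          DomainGeneralization.expectedError L (DomainGeneralization.model h g) (DS i)
        + Real.sqrt 2 * C *
          (⨅ i : Fin N, DomainGeneralization.jsDist
            (DomainGeneralization.lawXY DT) (DomainGeneralization.lawXY (DS i)))
        + Real.sqrt 2 * C *
          (⨆ ij : Fin N × Fin N, DomainGeneralization.jsDist
            (DomainGeneralization.lawZY g (DS ij.1))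
            (DomainGeneralization.lawZY g (DS ij.2))) := by
  open DomainGeneralization in
  have : Nonempty (Fin N) := ⟨⟨0, hN⟩⟩
  have : ProbabilityTheory.IsMarkovKernel (model h g) :=
    ProbabilityTheory.Kernel.IsMarkovKernel.map g hh
  have hC0 : 0 ≤ C := by
    obtain ⟨x, -, y⟩ :=
      (DT : MeasureTheory.Measure (X × A × Y)).nonempty_of_neZero.some
    obtain ⟨z⟩ := (g x).nonempty_of_neZero
    exact (hL_nonneg (h z) y).trans (hLC (h z) y)
  -- `i` is a source nearest to the target; it is the pivot of both comparisons.
  obtain ⟨i, hi⟩ := exists_eq_ciInf_of_finite (f := fun i : Fin N =>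
    jsDist (lawXY DT) (lawXY (DS i)))
  have hT := expectedError_sub_le_jsDist_lawXY (model h g) hL hL_nonneg hLC DT (DS i)
  rw [← hi]
  set S := ⨆ ij : Fin N × Fin N, jsDist (lawZY g (DS ij.1)) (lawZY g (DS ij.2)) with hS
  set e : Fin N → ℝ := fun j => expectedError L (model h g) (DS j) with he
  have hij : ∀ j, e i ≤ e j + Real.sqrt 2 * C * S := by
    intro j
    have h1 := expectedError_sub_le_jsDist_lawZY g hh hL hL_nonneg hLC (DS i) (DS j)
    have h2 : jsDist (lawZY g (DS i)) (lawZY g (DS j)) ≤ S :=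
      le_ciSup (f := fun ij : Fin N × Fin N => jsDist (lawZY g (DS ij.1)) (lawZY g (DS ij.2)))
        (Set.finite_range _).bddAbove (i, j)
    have h3 := mul_le_mul_of_nonneg_left h2 (by positivity : 0 ≤ Real.sqrt 2 * C)
    simp only [he]
    linarith
  have hN' : (0 : ℝ) < N := by exact_mod_cast hN
  have havg : e i ≤ 1 / (N : ℝ) * ∑ j, e j + Real.sqrt 2 * C * S := by
    -- Sum over all `j`, with `j = i` included, then divide by `N`.
    have hsum := Finset.sum_le_sum fun j (_ : j ∈ Finset.univ) => hij j
    rw [Finset.sum_add_distrib] at hsum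
    simp only [Finset.sum_const, Finset.card_univ, Fintype.card_fin, nsmul_eq_mul] at hsum
    rw [one_div, inv_mul_eq_div, ← sub_le_iff_le_add, le_div_iff₀ hN']
    linarith
  simp only [he] at havg ⊢
  linarith
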